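/- Conventions. A semi-metric on a set $X$ is a function $d:X\times X\to[0,\infty)$ with $d(x,y)=d(y,x)$ for all $x,y$, and $d(x,y)=0$ if and only if $x=y$ (no triangle inequality is required); put $B_d(x,\varepsilon)=\{y\in X: d(x,y)<\varepsilon\}$. A topological space $X$ is symmetrizable if there is a semi-metric $d$ on $X$ such that a set $O\subseteq X$ is open if and only if for every $x\in O$ there is $\varepsilon>0$ with $B_d(x,\varepsilon)\subseteq O$. A topological space $X$ has countable $S_0$-character (is weakly first-countable) if one can choose for every $x\in X$ a countable filter base $\mathcal{B}_x$ on $X$, all of whose members contain $x$, such that a set $U\subseteq X$ is open if and only if for every $x\in U$ there is $V\in\mathcal{B}_x$ with $V\subseteq U$. A topological space is locally countably compact if every point has a countably compact neighborhood. Products carry the product topology. Theorem. Let $X$ be a regular Hausdorff locally countably compact topological space. (1) If $X$ is symmetrizable, then $X\times Y$ is symmetrizable for every symmetrizable topological space $Y$. (2) If $X$ has countable $S_0$-character, then $X\times Y$ has countable $S_0$-character for every topological space $Y$ of countable $S_0$-character. -/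

import Mathlib

open Set Filter Topology

universe u v

/-- A semi-metric on `X`: a nonnegative symmetric function `d` such that `d x y = 0` exactly when
`x = y`. No triangle inequality is required. -/
structure IsSemimetric {X : Type u} (d : X → X → ℝ) : Prop where
  nonneg : ∀ x y, 0 ≤ d x y
  symm : ∀ x y, d x y = d y x
  eq_zero_iff : ∀ x y, d x y = 0 ↔ x = y

/-- The ball `{y | d x y < ε}` around `x` for an arbitrary function `d : X → X → ℝ`. -/
def semiBall {X : Type u} (d : X → X → ℝ) (x : X) (ε : ℝ) : Set X :=
  {y | d x y < ε}

/-- A topological space is symmetrizable if there is a semi-metric `d` such that a set `O` is open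
if and only if every point of `O` is the center of a ball for `d` that is contained in `O`. -/
def IsSymmetrizable (X : Type u) [TopologicalSpace X] : Prop :=
  ∃ d : X → X → ℝ, IsSemimetric d ∧
    ∀ O : Set X, IsOpen O ↔ ∀ x ∈ O, ∃ ε : ℝ, 0 < ε ∧ semiBall d x ε ⊆ O

/-- A weak base (also called a pretopological base, or `S₀`-base) of a topological space: a filter
base `B x` for every point `x`, all of whose members contain `x`, such that a set `U` is open if
and only if for every `x ∈ U` some member of `B x` is contained in `U`. -/
structure IsWeakBase {X : Type u} [TopologicalSpace X] (B : X → FilterBasis X) : Prop where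
  mem : ∀ x, ∀ V ∈ B x, x ∈ V
  isOpen_iff : ∀ U : Set X, IsOpen U ↔ ∀ x ∈ U, ∃ V ∈ B x, V ⊆ U

/-- A topological space has countable `S₀`-character (it is weakly first-countable, or g-first
countable) if it has a weak base which is countable at every point. -/
def HasCountableS0Character (X : Type u) [TopologicalSpace X] : Prop :=
  ∃ B : X → FilterBasis X, IsWeakBase B ∧ ∀ x, (B x).sets.Countable

/-- A topological space is locally countably compact if every point has a countably compact
neighborhood; equivalently, every convergent filter has a countably compact element. -/
def IsLocallyCountablyCompact (X : Type u) [TopologicalSpace X] : Prop :=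
  ∀ x : X, ∃ K ∈ 𝓝 x, IsCountablyCompact K

/-! Both properties say that filters `N x`, generated by balls or by a countable weak base,
determine the topology, so it suffices that products of such filters determine the product topology
(`DeterminesTopology.prod`). If `U` belongs to the product filter at each of its points, its
horizontal section through a point contains a closed countably compact neighborhood `K`, and the
tube of all `y` with `K × {y} ⊆ U` must be open. Otherwise a sequence in `K` witnesses failure, and
its cluster point must be one for `N a`, not merely for the possibly finer `𝓝 a`: this is
`DeterminesTopology.exists_frequently_mem`. -/

/-- A family of filters `N x`, each coarser than `pure x`, determines the topology of `X` if a set is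
open exactly when it belongs to `N x` for each of its points `x`. -/
structure DeterminesTopology {X : Type u} [TopologicalSpace X] (N : X → Filter X) : Prop where
  pure_le : ∀ x, pure x ≤ N x
  isOpen_iff : ∀ U : Set X, IsOpen U ↔ ∀ x ∈ U, U ∈ N x

/-- In a `T₁` space whose topology is determined by filters `N x`, every sequence in a closed
countably compact set has a cluster point with respect to these filters. -/
theorem DeterminesTopology.exists_frequently_mem {X : Type u} [TopologicalSpace X] [T1Space X]
    {N : X → Filter X} (hN : DeterminesTopology N) {K : Set X} (hKc : IsClosed K)
    (hK : IsCountablyCompact K) {u : ℕ → X} (hu : ∀ n, u n ∈ K) :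
    ∃ a ∈ K, ∀ V ∈ N a, ∃ᶠ n in atTop, u n ∈ V := by
  by_contra! h
  -- Some set of `N x` misses a late tail; the finitely many earlier terms form a closed set by
  -- `T₁`.
  have hopen : ∀ m, IsOpen (u '' Ici m)ᶜ := by
    intro m
    refine (hN.isOpen_iff _).2 fun x hx => ?_
    by_cases hxK : x ∈ K
    · obtain ⟨V, hV, hVu⟩ := h x hxK
      obtain ⟨k, hk⟩ := eventually_atTop.1 hVu
      have hfin : (u '' Ico m k)ᶜ ∈ N x :=
        (hN.isOpen_iff _).1 ((finite_Ico m k).image u).isClosed.isOpen_compl x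
          fun hx' => hx (image_mono Ico_subset_Ici_self hx')
      filter_upwards [hV, hfin] with z hzV hzf
      rintro ⟨n, hn, rfl⟩
      rcases lt_or_ge n k with hnk | hnk
      · exact hzf ⟨n, ⟨hn, hnk⟩, rfl⟩
      · exact hk n hnk hzV
    · filter_upwards [(hN.isOpen_iff _).1 hKc.isOpen_compl x hxK] with z hz
      rintro ⟨n, -, rfl⟩
      exact hz (hu n)
  obtain ⟨a, haK, ha⟩ := hK.seq_clusterPt u (Eventually.of_forall hu)
  obtain ⟨V, hV, hVu⟩ := h a haK
  obtain ⟨k, hk⟩ := eventually_atTop.1 hVu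
  -- Since `a ∈ V`, no term from `k` on equals `a`.
  have hak : a ∈ (u '' Ici k)ᶜ := by
    rintro ⟨n, hn, rfl⟩
    exact hk n hn (hN.pure_le _ hV)
  have hfreq := mapClusterPt_iff_frequently.1 ha _ ((hopen k).mem_nhds hak)
  obtain ⟨n, hn, hnk⟩ := (hfreq.and_eventually (eventually_ge_atTop k)).exists
  exact hn ⟨n, hnk, rfl⟩

/-- If the topology of a regular Hausdorff locally countably compact space `X` is determined by
filters `N x`, and that of `Y` by countably generated filters `M y`, then the product topology is
determined by the products of these filters. -/
theorem DeterminesTopology.prod {X : Type u} {Y : Type v} [TopologicalSpace X]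
    [TopologicalSpace Y] [RegularSpace X] [T2Space X] (hX : IsLocallyCountablyCompact X)
    {N : X → Filter X} {M : Y → Filter Y} (hN : DeterminesTopology N)
    (hM : DeterminesTopology M) [∀ y, (M y).IsCountablyGenerated] :
    DeterminesTopology fun p : X × Y => N p.1 ×ˢ M p.2 where
  pure_le p := by
    rw [← prod_pure_pure]
    exact Filter.prod_mono (hN.pure_le _) (hM.pure_le _)
  isOpen_iff U := by
    refine ⟨fun hU p hp => ?_, fun hU => ?_⟩
    · obtain ⟨S, T, hS, hT, hpS, hpT, hST⟩ := isOpen_prod_iff.1 hU p.1 p.2 hp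
      exact mem_of_superset
        (prod_mem_prod ((hN.isOpen_iff S).1 hS _ hpS) ((hM.isOpen_iff T).1 hT _ hpT)) hST
    · rw [isOpen_iff_mem_nhds]
      rintro ⟨x₀, y₀⟩ hp
      have hsec : IsOpen {x | (x, y₀) ∈ U} := by
        refine (hN.isOpen_iff _).2 fun x hx => ?_
        obtain ⟨V, hV, T, hT, hVT⟩ := mem_prod_iff.1 (hU (x, y₀) hx)
        exact mem_of_superset hV fun z hz => hVT ⟨hz, hM.pure_le _ hT⟩
      obtain ⟨C, hC, hCc⟩ := hX x₀
      obtain ⟨K, hK, hKc, hKsub⟩ :=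
        exists_mem_nhds_isClosed_subset (inter_mem (hsec.mem_nhds hp) hC)
      have hKcc : IsCountablyCompact K :=
        hCc.of_isClosed_subset hKc (hKsub.trans inter_subset_right)
      have hO : IsOpen {y | ∀ x ∈ K, (x, y) ∈ U} := by
        refine (hM.isOpen_iff _).2 fun y hy => ?_
        obtain ⟨W, hW⟩ := (M y).exists_antitone_basis
        by_contra hcon
        have hbad : ∀ n, ∃ x ∈ K, ∃ w ∈ W n, (x, w) ∉ U := by
          intro n
          by_contra! hn
          exact hcon (mem_of_superset (hW.mem n) fun w hw x hx => hn x hx w hw)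
        choose x hxK w hw hxw using hbad
        obtain ⟨a, haK, ha⟩ := hN.exists_frequently_mem hKc hKcc hxK
        obtain ⟨V, hV, T, hT, hVT⟩ := mem_prod_iff.1 (hU (a, y) (hy a haK))
        -- Frequently `x n ∈ V`, eventually `W n ⊆ T`: some bad pair lies in `V ×ˢ T ⊆ U`.
        obtain ⟨n, hnV, hnT⟩ := ((ha V hV).and_eventually (hW.eventually_subset hT)).exists
        exact hxw n (hVT ⟨hnV, hnT (hw n)⟩)
      exact mem_of_superset
        (prod_mem_nhds hK (hO.mem_nhds fun x hx => (hKsub hx).1)) fun q hq => hq.2 _ hq.1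

theorem IsSemimetric.hasBasis_comap {X : Type u} {d : X → X → ℝ} (hd : IsSemimetric d) (x : X) :
    (comap (d x) (𝓝 0)).HasBasis (fun ε : ℝ => 0 < ε) (semiBall d x) := by
  convert Metric.nhds_basis_ball.comap (d x) using 2 with ε
  ext y
  simp [semiBall, abs_of_nonneg (hd.nonneg x y)]

theorem IsSemimetric.determinesTopology_iff {X : Type u} [TopologicalSpace X] {d : X → X → ℝ}
    (hd : IsSemimetric d) :
    DeterminesTopology (fun x => comap (d x) (𝓝 0)) ↔
      ∀ O : Set X, IsOpen O ↔ ∀ x ∈ O, ∃ ε : ℝ, 0 < ε ∧ semiBall d x ε ⊆ O := by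
  simp only [← (hd.hasBasis_comap _).mem_iff]
  refine ⟨fun h => h.isOpen_iff, fun h => ⟨fun x => ?_, h⟩⟩
  refine (hd.hasBasis_comap x).ge_iff.2 fun ε hε => ?_
  simpa [semiBall, (hd.eq_zero_iff x x).2 rfl] using hε

theorem IsSemimetric.prod {X : Type u} {Y : Type v} {d : X → X → ℝ} {e : Y → Y → ℝ}
    (hd : IsSemimetric d) (he : IsSemimetric e) :
    IsSemimetric fun p q : X × Y => max (d p.1 q.1) (e p.2 q.2) where
  nonneg p q := le_max_of_le_left (hd.nonneg _ _)
  symm p q := by rw [hd.symm, he.symm]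
  eq_zero_iff p q := by
    rw [Prod.ext_iff, ← hd.eq_zero_iff, ← he.eq_zero_iff]
    have h₁ := hd.nonneg p.1 q.1
    have h₂ := he.nonneg p.2 q.2
    refine ⟨fun h => ⟨?_, ?_⟩, fun h => by simp [h.1, h.2]⟩
    · exact le_antisymm (h ▸ le_max_left _ _) h₁
    · exact le_antisymm (h ▸ le_max_right _ _) h₂

/-- A ball for the maximum is the product of two balls of the same radius, and equal radii suffice
because balls grow with the radius. -/
theorem IsSemimetric.comap_prod {X : Type u} {Y : Type v} {d : X → X → ℝ} {e : Y → Y → ℝ}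
    (hd : IsSemimetric d) (he : IsSemimetric e) (p : X × Y) :
    comap (fun q : X × Y => max (d p.1 q.1) (e p.2 q.2)) (𝓝 0) =
      comap (d p.1) (𝓝 0) ×ˢ comap (e p.2) (𝓝 0) := by
  refine ((hd.prod he).hasBasis_comap p).eq_of_same_basis ?_
  convert (hd.hasBasis_comap p.1).prod_same_index_mono (he.hasBasis_comap p.2)
    (fun _ _ _ _ h _ hz => lt_of_lt_of_le hz h) (fun _ _ _ _ h _ hz => lt_of_lt_of_le hz h) using 2
  ext q
  simp [semiBall]

theorem isWeakBase_iff_determinesTopology {X : Type u} [TopologicalSpace X]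
    {B : X → FilterBasis X} :
    IsWeakBase B ↔ DeterminesTopology fun x => (B x).filter := by
  refine ⟨fun h => ⟨fun x => ?_, h.isOpen_iff⟩, fun h => ⟨fun x V hV => ?_, h.isOpen_iff⟩⟩
  · rintro S ⟨V, hV, hVS⟩
    exact hVS (h.mem x V hV)
  · exact h.pure_le x ((B x).mem_filter_of_mem hV)

theorem FilterBasis.isCountablyGenerated_filter {X : Type u} (B : FilterBasis X)
    (hB : B.sets.Countable) : B.filter.IsCountablyGenerated :=
  HasCountableBasis.isCountablyGenerated ⟨B.hasBasis, hB⟩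

/-- The filter basis of all products of a member of `B` with a member of `C`. -/
def FilterBasis.prod {X : Type u} {Y : Type v} (B : FilterBasis X) (C : FilterBasis Y) :
    FilterBasis (X × Y) where
  sets := image2 (· ×ˢ ·) B.sets C.sets
  nonempty := B.nonempty.image2 C.nonempty
  inter_sets := by
    rintro _ _ ⟨S, hS, T, hT, rfl⟩ ⟨S', hS', T', hT', rfl⟩
    obtain ⟨S'', hS'', hSS⟩ := B.inter_sets hS hS'
    obtain ⟨T'', hT'', hTT⟩ := C.inter_sets hT hT'
    exact ⟨_, mem_image2_of_mem hS'' hT'', (prod_mono hSS hTT).trans prod_inter_prod.superset⟩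

theorem FilterBasis.filter_prod {X : Type u} {Y : Type v} (B : FilterBasis X)
    (C : FilterBasis Y) : (B.prod C).filter = B.filter ×ˢ C.filter := by
  ext U
  rw [(B.hasBasis.prod C.hasBasis).mem_iff, FilterBasis.mem_filter_iff]
  constructor
  · rintro ⟨_, ⟨S, hS, T, hT, rfl⟩, h⟩
    exact ⟨(S, T), ⟨hS, hT⟩, h⟩
  · rintro ⟨⟨S, T⟩, ⟨hS, hT⟩, h⟩
    exact ⟨_, mem_image2_of_mem hS hT, h⟩

theorem theorem6p1 (X : Type u) [TopologicalSpace X] [RegularSpace X] [T2Space X]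
    (hX : IsLocallyCountablyCompact X) :
    (IsSymmetrizable X →
      ∀ (Y : Type v) [TopologicalSpace Y], IsSymmetrizable Y → IsSymmetrizable (X × Y)) ∧
    (HasCountableS0Character X →
      ∀ (Y : Type v) [TopologicalSpace Y],
        HasCountableS0Character Y → HasCountableS0Character (X × Y)) := by
  constructor
  · rintro ⟨d, hd, hdX⟩ Y _ ⟨e, he, heY⟩
    refine ⟨_, hd.prod he, (hd.prod he).determinesTopology_iff.1 ?_⟩
    simp only [hd.comap_prod he]
    exact (hd.determinesTopology_iff.2 hdX).prod hX (he.determinesTopology_iff.2 heY)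
  · rintro ⟨B, hB, hBc⟩ Y _ ⟨C, hC, hCc⟩
    refine ⟨fun p => (B p.1).prod (C p.2), ?_, fun p => (hBc p.1).image2 (hCc p.2) _⟩
    have := fun y => (C y).isCountablyGenerated_filter (hCc y)
    rw [isWeakBase_iff_determinesTopology] at hB hC ⊢
    simp only [FilterBasis.filter_prod]
    exact hB.prod hX hC
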